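/- Let $\mathcal M$ be an infinite first-order structure in a language $\mathcal L$, with universe $M$. (Structures are denoted by script letters and their universes by the corresponding roman letters; $\mathcal N\succ\mathcal M$ means that $\mathcal N$ is an elementary extension of $\mathcal M$, and the extension is proper if $N\neq M$.) (A) For every cardinal $\kappa\ge\max\{|M|,|\mathcal L|\}$ there are a proper elementary extension $\mathcal M^*$ of $\mathcal M$ with $|M^*|=\kappa$ and an automorphism $\alpha$ of $\mathcal M^*$ such that for every integer $n\ge 1$ the iterate $\alpha^n$ fixes every element of $M$ and moves every element of $M^*\setminus M$. (B) There is a family $\{\mathcal M_i : i\in\omega\}$ of proper elementary extensions of $\mathcal M$ such that $\mathcal M_i$ is a proper elementary extension of $\mathcal M_{i+1}$ for every $i$, and $\bigcap_{i\in\omega}M_i=M$. (C) For every set $I$ there is a family $\{\mathcal M_S : S\subseteq I\}$ of elementary extensions of $\mathcal M$, with $\mathcal M_S$ a proper extension of $\mathcal M$ for every nonempty $S$, such that $\mathcal M_{S_1}$ is an elementary extension of $\mathcal M_{S_0}$ (possibly equal to it) whenever $S_0\subseteq S_1\subseteq I$, and $M_{S_0}\cap M_{S_1}=M$ for all disjoint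 $S_0,S_1\subseteq I$. (In particular $\mathcal M_\emptyset=\mathcal M$.) -/

import Mathlib

open scoped FirstOrder

universe u v w z t

/-! Iterate a nonprincipal ultrafilter `U` on `M` along a linear order `I`: a property of finitely
many coordinates is large when it holds under the nested quantifiers "for `U`-almost all values",
the largest coordinate innermost. In the resulting ultrapower of `M`, let `supported S` consist of
the classes of functions depending on finitely many coordinates, all in `S`. It is an elementary
substructure because Skolem functions add no new coordinates. Each coordinate function is a new
element, since `U` is nonprincipal. The crux is `exists_eventually_listUltrafilter_eq`: functions
with disjoint supports that agree almost everywhere are constant almost everywhere. Hence `supported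
S` and `supported T` meet exactly in `M` for disjoint `S`, `T`. This gives (C) directly, and (B)
from the final segments of ℕ. For (A), an automorphism of `I` permutes coordinates and so acts on
the finitely supported elements. Take `I` to be κ copies of ℤ, shifted by one. An element fixed by a
positive iterate is also fixed by powers of it that move its support off itself, so it lies in `M`.
Downward Löwenheim–Skolem, with the automorphism in the language, then gives cardinality exactly κ.
-/

namespace IteratedUltrapower

open Filter Function FirstOrder FirstOrder.Language

/-! ### Iterated products of an ultrafilter along a linear order. -/

section Ultrafilter

variable {I : Type*} {X : Type*} [LinearOrder I] (U : Ultrafilter X) (c : X)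

/-- The product of `U` with itself along a list of coordinates, the head of the list being the
innermost quantifier; the coordinates outside the list are set to `c`. -/
noncomputable def listUltrafilter : List I → Ultrafilter (I → X)
  | [] => pure fun _ => c
  | i :: l => (listUltrafilter l).bind fun y => U.map (update y i)

theorem eventually_listUltrafilter_cons (i : I) (l : List I) (P : (I → X) → Prop) :
    (∀ᶠ x in (listUltrafilter U c (i :: l) : Filter (I → X)), P x) ↔
      ∀ᶠ y in (listUltrafilter U c l : Filter (I → X)),
        ∀ᶠ m in (U : Filter X), P (update y i m) :=
  Iff.rfl

theorem dependsOn_eventually_update {P : (I → X) → Prop} {s : Set I} (hP : DependsOn P s) (i : I) :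
    DependsOn (fun y => ∀ᶠ m in (U : Filter X), P (update y i m)) s := by
  intro x y h
  have : ∀ m, P (update x i m) = P (update y i m) := fun m => hP fun j hj => by
    by_cases hji : j = i
    · subst hji; simp
    · simp [hji, h j hj]
  simp only [this]

theorem _root_.DependsOn.update_of_notMem {β : Type*} {f : (I → X) → β} {s : Set I}
    (hf : DependsOn f s) {i : I} (hi : i ∉ s) (y : I → X) (m : X) : f (update y i m) = f y :=
  hf fun j hj => update_of_ne (fun h : j = i => hi (h ▸ hj)) _ _

/-- A quantifier over a coordinate on which `P` does not depend is vacuous and can be dropped. -/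
theorem eventually_listUltrafilter_filter (s : Finset I) (l : List I) :
    ∀ {P : (I → X) → Prop}, DependsOn P (s : Set I) →
      ((∀ᶠ x in (listUltrafilter U c (l.filter (· ∈ s)) : Filter (I → X)), P x) ↔
        ∀ᶠ x in (listUltrafilter U c l : Filter (I → X)), P x) := by
  induction l with
  | nil => intro P _; rfl
  | cons i l ih =>
    intro P hP
    rw [eventually_listUltrafilter_cons]
    by_cases hi : i ∈ s
    · rw [List.filter_cons_of_pos (by simpa using hi), eventually_listUltrafilter_cons]
      exact ih (dependsOn_eventually_update U hP i)
    · rw [List.filter_cons_of_neg (by simpa using hi), ih hP]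
      have : ∀ y m, P (update y i m) = P y := hP.update_of_notMem (by simpa using hi)
      simp [this]

/-- If two functions with disjoint supports agree almost everywhere, then they are constant
almost everywhere. -/
theorem exists_eventually_listUltrafilter_eq {Y : Type*} [Nonempty Y] (l : List I) :
    ∀ {f g : (I → X) → Y} {s t : Set I}, DependsOn f s → DependsOn g t → Disjoint s t →
      (∀ᶠ x in (listUltrafilter U c l : Filter (I → X)), f x = g x) →
      ∃ b, ∀ᶠ x in (listUltrafilter U c l : Filter (I → X)), f x = b := by
  induction l with
  | nil => intro f g s t _ _ _ _; exact ⟨f fun _ => c, rfl⟩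
  | cons i l ih =>
    -- The innermost coordinate `i` lies in at most one support; by symmetry, suppose `g` does not
    -- depend on it.
    have key : ∀ {f g : (I → X) → Y} {s t : Set I}, DependsOn f s → DependsOn g t →
        Disjoint s t → i ∉ t →
        (∀ᶠ x in (listUltrafilter U c (i :: l) : Filter (I → X)), f x = g x) →
        ∃ b, ∀ᶠ x in (listUltrafilter U c (i :: l) : Filter (I → X)), g x = b := by
      intro f g s t hf hg hst hi h
      have hgu := hg.update_of_notMem hi
      simp only [eventually_listUltrafilter_cons, hgu, eventually_const] at h ⊢
      -- Integrate `i` out of `f`: take the value assumed for `U`-almost all `m`, with a junk value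
      -- where there is none. The support stays inside `s`, so induction applies to `f'` and `g`.
      let f' : (I → X) → Y := fun y =>
        Classical.epsilon fun b => ∀ᶠ m in (U : Filter X), f (update y i m) = b
      have hf' : DependsOn f' s := by
        intro x y hxy
        have : ∀ b, (∀ᶠ m in (U : Filter X), f (update x i m) = b) =
            ∀ᶠ m in (U : Filter X), f (update y i m) = b := fun b =>
          dependsOn_eventually_update U (P := fun x => f x = b)
            (fun x y h => by simp only [hf h]) i hxy
        simp only [f', this]
      have hfg : ∀ᶠ y in (listUltrafilter U c l : Filter (I → X)), f' y = g y := by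
        filter_upwards [h] with y hy
        have := Classical.epsilon_spec
          (p := fun b => ∀ᶠ m in (U : Filter X), f (update y i m) = b) ⟨_, hy⟩
        obtain ⟨m, h1, h2⟩ := (this.and hy).exists
        exact h1.symm.trans h2
      obtain ⟨b, hb⟩ := ih hf' hg hst hfg
      exact ⟨b, by filter_upwards [hfg, hb] with y h1 h2 using h1.symm.trans h2⟩
    intro f g s t hf hg hst h
    by_cases hi : i ∈ t
    · exact key hg hf hst.symm (fun his => hst.le_bot ⟨his, hi⟩) (h.mono fun _ => Eq.symm)
    · obtain ⟨b, hb⟩ := key hf hg hst hi h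
      exact ⟨b, by filter_upwards [h, hb] with x h1 h2 using h1.trans h2⟩

theorem eventually_listUltrafilter_map (σ : I ≃ I) (l : List I) : ∀ (P : (I → X) → Prop),
    (∀ᶠ x in (listUltrafilter U c (l.map σ) : Filter (I → X)), P (x ∘ σ)) ↔
      ∀ᶠ x in (listUltrafilter U c l : Filter (I → X)), P x := by
  induction l with
  | nil => intro P; rfl
  | cons i l ih =>
    intro P
    rw [List.map_cons, eventually_listUltrafilter_cons, eventually_listUltrafilter_cons, ← ih]
    simp only [update_comp_eq_of_injective _ σ.injective]

variable (I) in
/-- The iteration of `U` along the linear order `I`. -/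
noncomputable def orderUltrafilter : Ultrafilter (I → X) :=
  (Ultrafilter.of (atTop : Filter (Finset I))).bind fun s =>
    listUltrafilter U c (s.sort (· ≥ ·))

/-- Almost every finite set contains `s`, and its coordinates outside `s` are irrelevant to `P`.
Thus the arbitrary ultrafilter above `atTop` has no influence on finitely supported properties. -/
theorem eventually_orderUltrafilter {P : (I → X) → Prop} {s : Finset I}
    (hP : DependsOn P (s : Set I)) :
    (∀ᶠ x in (orderUltrafilter I U c : Filter (I → X)), P x) ↔
      ∀ᶠ x in (listUltrafilter U c (s.sort (· ≥ ·)) : Filter (I → X)), P x := by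
  have h1 : (∀ᶠ x in (orderUltrafilter I U c : Filter (I → X)), P x) ↔
      ∀ᶠ r in (Ultrafilter.of (atTop : Filter (Finset I)) : Filter (Finset I)),
        ∀ᶠ x in (listUltrafilter U c (r.sort (· ≥ ·)) : Filter (I → X)), P x := Iff.rfl
  rw [h1]
  have h2 : ∀ᶠ r in (Ultrafilter.of (atTop : Filter (Finset I)) : Filter (Finset I)),
      ((∀ᶠ x in (listUltrafilter U c (r.sort (· ≥ ·)) : Filter (I → X)), P x) ↔
        ∀ᶠ x in (listUltrafilter U c (s.sort (· ≥ ·)) : Filter (I → X)), P x) := by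
    refine Ultrafilter.of_le _ ((eventually_ge_atTop s).mono fun r hr => ?_)
    rw [← eventually_listUltrafilter_filter U c s _ hP]
    have : (r.sort (· ≥ ·)).filter (· ∈ s) = s.sort (· ≥ ·) := by
      refine List.Perm.eq_of_pairwise' (r := (· ≥ ·)) ((Finset.pairwise_sort r _).filter _)
        (Finset.pairwise_sort s _) ?_
      refine (List.perm_ext_iff_of_nodup ((Finset.sort_nodup r _).filter _)
        (Finset.sort_nodup s _)).2 fun i => ?_
      simpa using fun h => hr h
    rw [this]
  rw [eventually_congr h2, eventually_const]

theorem exists_eventually_orderUltrafilter_eq {Y : Type*} [Nonempty Y] {f g : (I → X) → Y}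
    {s t : Finset I} (hf : DependsOn f (s : Set I)) (hg : DependsOn g (t : Set I))
    (hst : Disjoint (s : Set I) t)
    (h : ∀ᶠ x in (orderUltrafilter I U c : Filter (I → X)), f x = g x) :
    ∃ b, ∀ᶠ x in (orderUltrafilter I U c : Filter (I → X)), f x = b := by
  have hf' := hf.mono (Finset.coe_subset.2 (Finset.subset_union_left (s₂ := t)))
  have hg' := hg.mono (Finset.coe_subset.2 (Finset.subset_union_right (s₁ := s)))
  rw [eventually_orderUltrafilter U c (s := s ∪ t)
    (fun x y h => by simp only [hf' h, hg' h])] at h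
  obtain ⟨b, hb⟩ := exists_eventually_listUltrafilter_eq U c _ hf hg hst h
  exact ⟨b, (eventually_orderUltrafilter U c (fun x y h => by simp only [hf' h])).2 hb⟩

theorem dependsOn_comp {I X β : Type*} (σ : I ≃ I) {f : (I → X) → β} {s : Finset I}
    (hf : DependsOn f (s : Set I)) :
    DependsOn (fun x => f (x ∘ σ)) ((s.map σ.toEmbedding : Finset I) : Set I) :=
  fun _ _ h => hf fun i hi => h (σ i) (by simpa using hi)

/-- An order automorphism carries the decreasing enumeration of `s` to that of its image, so the
quantifiers stay in the same order. -/
theorem eventually_orderUltrafilter_comp (σ : I ≃o I) {P : (I → X) → Prop} {s : Finset I}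
    (hP : DependsOn P (s : Set I)) :
    (∀ᶠ x in (orderUltrafilter I U c : Filter (I → X)), P (x ∘ σ)) ↔
      ∀ᶠ x in (orderUltrafilter I U c : Filter (I → X)), P x := by
  have h1 := eventually_orderUltrafilter U c (dependsOn_comp σ.toEquiv hP)
  have h2 : (s.map σ.toEquiv.toEmbedding).sort (· ≥ ·) = (s.sort (· ≥ ·)).map σ.toEquiv :=
    (Finset.map_sort (r := (· ≥ ·)) (r' := (· ≥ ·)) _ _ (fun _ _ _ _ => by simp)).symm
  rw [h2, eventually_listUltrafilter_map, ← eventually_orderUltrafilter U c hP] at h1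
  exact h1

theorem not_eventually_orderUltrafilter_eq (hU : ∀ m, ∀ᶠ a in (U : Filter X), a ≠ m) (i : I)
    (m : X) : ¬∀ᶠ x in (orderUltrafilter I U c : Filter (I → X)), x i = m := by
  rw [eventually_orderUltrafilter U c (s := {i}) (fun x y h => by simp [h i (by simp)]),
    Finset.sort_singleton, eventually_listUltrafilter_cons]
  simp only [update_self, eventually_const]
  intro h
  obtain ⟨a, h1, h2⟩ := (h.and (hU m)).exists
  exact h2 h1

end Ultrafilter

/-! ### Finitely supported elements of the iterated ultrapower. -/

section Model

variable (L : FirstOrder.Language.{u, v}) {M : Type w} [L.Structure M] {I : Type t}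

section Ultrapower

variable (V : Ultrafilter (I → M))

/-- The ultrapower of `M` by an ultrafilter on `I → M`. -/
abbrev Power : Type max w t :=
  (V : Filter (I → M)).Product fun _ => M

variable {V} in
/-- The class of a function in the ultrapower. -/
abbrev toPower (f : (I → M) → M) : Power V :=
  (f : (V : Filter (I → M)).Product fun _ => M)

theorem toPower_eq_iff {f g : (I → M) → M} :
    (toPower f : Power V) = toPower g ↔ ∀ᶠ x in (V : Filter (I → M)), f x = g x :=
  Quotient.eq''

theorem exists_uniform_support {S : Set I} {n : ℕ} (x : Fin n → Power V)
    (hx : ∀ k, ∃ (s : Finset I) (f : (I → M) → M),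
      (s : Set I) ⊆ S ∧ DependsOn f (s : Set I) ∧ toPower f = x k) :
    ∃ (s : Finset I) (f : Fin n → (I → M) → M), (s : Set I) ⊆ S ∧
      (∀ k, DependsOn (f k) (s : Set I)) ∧ x = fun k => toPower (f k) := by
  classical
  choose s f hs hf hx using hx
  refine ⟨Finset.univ.biUnion s, f, by simpa using hs, fun k => (hf k).mono ?_,
    funext fun k => (hx k).symm⟩
  exact Finset.coe_subset.2 (Finset.subset_biUnion_of_mem s (Finset.mem_univ k))

variable [Nonempty M]

/-- The diagonal embedding. -/
def diagonal : M ↪ₑ[L] Power V where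
  toFun m := toPower fun _ => m
  map_formula' n φ x := by
    refine (Ultraproduct.realize_formula_cast (u := V) φ fun i _ => x i).trans ?_
    simp

/-- The elements of the ultrapower represented by functions with finite support in `S`. -/
def supportedSubstructure (S : Set I) : L.Substructure (Power V) where
  carrier := {q | ∃ (s : Finset I) (f : (I → M) → M),
    (s : Set I) ⊆ S ∧ DependsOn f (s : Set I) ∧ toPower f = q}
  fun_mem {n} F x hx := by
    obtain ⟨s, f, hs, hf, rfl⟩ := exists_uniform_support V x hx
    refine ⟨s, fun y => Structure.funMap F fun k => f k y, hs, fun y z h => ?_, ?_⟩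
    · simp only [fun k => hf k h]
    · exact (Ultraproduct.funMap_cast F f).symm

/-- `supportedSubstructure` as an elementary substructure. -/
def supported (S : Set I) : L.ElementarySubstructure (Power V) :=
  (supportedSubstructure L V S).toElementarySubstructure fun n φ x a ha => by
    obtain ⟨s, f, hs, hf, hx⟩ := exists_uniform_support V (fun k => (x k : Power V))
      fun k => (x k).2
    -- Tarski–Vaught witness: a pointwise choice made from the values `f k y` alone, hence supported
    -- on the same `s`.
    let g : (I → M) → M := fun y =>
      Classical.epsilon fun b => φ.Realize default (Fin.snoc (fun k => f k y) b)
    have hsnoc : ∀ (h : (I → M) → M), (Fin.snoc (Subtype.val ∘ x) (toPower h) : _ → Power V) =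
        fun k => toPower ((Fin.snoc f h : Fin (n + 1) → (I → M) → M) k) := by
      intro h
      have : Subtype.val ∘ x = toPower ∘ f := hx
      rw [this, ← Fin.comp_snoc]
      rfl
    have key : ∀ (h : (I → M) → M),
        φ.Realize default (Fin.snoc (Subtype.val ∘ x) (toPower h) : _ → Power V) ↔
          ∀ᶠ y in (V : Filter (I → M)),
            φ.Realize default (Fin.snoc (fun k => f k y) (h y) : _ → M) := by
      intro h
      rw [hsnoc h, Subsingleton.elim (default : Empty → Power V)
        (fun i => toPower (Empty.elim i))]
      refine (Ultraproduct.boundedFormula_realize_cast φ _ _).trans ?_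
      refine eventually_congr (Eventually.of_forall fun y => ?_)
      rw [Subsingleton.elim (default : Empty → M) _]
      refine Eq.to_iff (congrArg _ (funext fun k => ?_))
      refine Fin.lastCases ?_ (fun k => ?_) k <;> simp
    refine ⟨⟨toPower g, s, g, hs, fun y z h => ?_, rfl⟩, ?_⟩
    · simp only [g, fun k => hf k h]
    · obtain ⟨h, rfl⟩ := Quotient.exists_rep a
      exact (key g).2 (((key h).1 ha).mono fun y hy =>
        Classical.epsilon_spec (p := fun b => φ.Realize default
          (Fin.snoc (fun k => f k y) b : _ → M)) ⟨_, hy⟩)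

variable {V}

theorem supported_mono {S T : Set I} (h : S ⊆ T) : supported L V S ≤ supported L V T :=
  fun _ ⟨s, f, hs, hf⟩ => ⟨s, f, hs.trans h, hf⟩

theorem diagonal_mem_supported (S : Set I) (m : M) : diagonal L V m ∈ supported L V S :=
  ⟨∅, fun _ => m, by simp, fun _ _ _ => rfl, rfl⟩

theorem coordinate_mem_supported {S : Set I} {i : I} (hi : i ∈ S) :
    (toPower fun x => x i : Power V) ∈ supported L V S :=
  ⟨{i}, _, by simpa using hi, fun x y h => h i (by simp), rfl⟩

theorem exists_finset_mem_supported {S : Set I} {q : Power V} (hq : q ∈ supported L V S) :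
    ∃ s : Finset I, q ∈ supported L V (s : Set I) :=
  let ⟨s, f, _, hf⟩ := hq
  ⟨s, s, f, subset_rfl, hf⟩

theorem relMap_toPower {n : ℕ} (R : L.Relations n)
    (f : Fin n → (I → M) → M) :
    Structure.RelMap R (fun k => (toPower (f k) : Power V)) ↔
      ∀ᶠ y in (V : Filter (I → M)), Structure.RelMap R fun k => f k y := by
  have := Ultraproduct.realize_formula_cast (u := V) (R.formula fun k => Term.var k) f
  simp only [Formula.realize_rel] at this
  exact this

end Ultrapower

variable [Nonempty M] [LinearOrder I] (U : Ultrafilter M) (c : M)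

theorem supported_inter_supported {S T : Set I} (h : Disjoint S T) :
    (supported L (orderUltrafilter I U c) S : Set (Power (orderUltrafilter I U c))) ∩
      supported L (orderUltrafilter I U c) T = Set.range (diagonal L (orderUltrafilter I U c)) := by
  refine subset_antisymm ?_ ?_
  · rintro q ⟨⟨s, f, hs, hf, rfl⟩, t, g, ht, hg, hfg⟩
    obtain ⟨b, hb⟩ := exists_eventually_orderUltrafilter_eq U c hf hg (h.mono hs ht)
      ((toPower_eq_iff _).1 hfg.symm)
    exact ⟨b, ((toPower_eq_iff _).2 hb).symm⟩
  · rintro _ ⟨m, rfl⟩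
    exact ⟨diagonal_mem_supported L S m, diagonal_mem_supported L T m⟩

theorem coordinate_notMem_range (hU : ∀ m, ∀ᶠ a in (U : Filter M), a ≠ m) (i : I) :
    (toPower fun x => x i : Power (orderUltrafilter I U c)) ∉
      Set.range (diagonal L (orderUltrafilter I U c)) := by
  rintro ⟨m, hm⟩
  exact not_eventually_orderUltrafilter_eq U c hU i m ((toPower_eq_iff _).1 hm.symm)

theorem coordinate_injective (hU : ∀ m, ∀ᶠ a in (U : Filter M), a ≠ m) :
    Injective fun i : I => (toPower fun x => x i : Power (orderUltrafilter I U c)) := by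
  intro i j hij
  by_contra hne
  obtain ⟨m, hm⟩ := exists_eventually_orderUltrafilter_eq U c (s := {i}) (t := {j})
    (f := fun x => x i) (g := fun x => x j) (fun x y h => h i (by simp))
    (fun x y h => h j (by simp)) (by simpa using hne) ((toPower_eq_iff _).1 hij)
  exact not_eventually_orderUltrafilter_eq U c hU i m hm

/-! ### Automorphisms induced by the index order. -/

section Shift

/-- The map of the finitely supported elements induced by an automorphism of the index order. -/
noncomputable def shift (σ : I ≃o I) (q : supported L (orderUltrafilter I U c) Set.univ) :
    supported L (orderUltrafilter I U c) Set.univ :=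
  ⟨toPower fun x => q.2.choose_spec.choose (x ∘ σ), _, _, Set.subset_univ _,
    dependsOn_comp σ.toEquiv q.2.choose_spec.choose_spec.2.1, rfl⟩

/-- Independence of the chosen representative: two finitely supported representatives agree almost
everywhere, and this survives composition with `σ` by invariance of the ultrafilter. -/
theorem coe_shift (σ : I ≃o I) {s : Finset I} {f : (I → M) → M} (hf : DependsOn f (s : Set I))
    (q : supported L (orderUltrafilter I U c) Set.univ) (hq : toPower f = (q : Power (orderUltrafilter I U c))) :
    (shift L U c σ q : Power (orderUltrafilter I U c)) = toPower fun x => f (x ∘ σ) := by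
  have hg := q.2.choose_spec.choose_spec.2.1
  have hgq := q.2.choose_spec.choose_spec.2.2
  set t := q.2.choose
  set g := q.2.choose_spec.choose
  refine (toPower_eq_iff _).2 ?_
  have hf' := hf.mono (Finset.coe_subset.2 (Finset.subset_union_left (s₂ := t)))
  have hg' := hg.mono (Finset.coe_subset.2 (Finset.subset_union_right (s₁ := s)))
  refine (eventually_orderUltrafilter_comp U c σ (P := fun x => g x = f x) (s := s ∪ t)
    fun x y h => by simp only [hf' h, hg' h]).2 ?_
  exact (toPower_eq_iff _).1 (hgq.trans hq.symm)

theorem shift_shift {σ τ : I ≃o I} (h : ∀ i, σ (τ i) = i)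
    (q : supported L (orderUltrafilter I U c) Set.univ) :
    shift L U c σ (shift L U c τ q) = q := by
  obtain ⟨s, f, -, hf, hq⟩ := q.2
  refine Subtype.ext ?_
  rw [coe_shift L U c σ (dependsOn_comp τ.toEquiv hf) _ (coe_shift L U c τ hf q hq).symm, ← hq]
  congr 1
  funext x
  simp [comp_def, h]

theorem exists_representatives {n : ℕ}
    (x : Fin n → supported L (orderUltrafilter I U c) Set.univ) :
    ∃ (s : Finset I) (f : Fin n → (I → M) → M), (∀ k, DependsOn (f k) (s : Set I)) ∧
      (∀ k, (x k : Power (orderUltrafilter I U c)) = toPower (f k)) ∧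
      ∀ σ : I ≃o I, ∀ k, (shift L U c σ (x k) : Power (orderUltrafilter I U c)) = toPower fun y => f k (y ∘ σ) := by
  obtain ⟨s, f, -, hf, hx⟩ := exists_uniform_support _ (fun k => (x k : Power (orderUltrafilter I U c))) fun k => (x k).2
  exact ⟨s, f, hf, congrFun hx,
    fun σ k => coe_shift L U c σ (hf k) (x k) (congrFun hx k).symm⟩

/-- `shift` as an automorphism of the structure of finitely supported elements. -/
noncomputable def shiftEquiv (σ : I ≃o I) :
    supported L (orderUltrafilter I U c) Set.univ ≃[L]
      supported L (orderUltrafilter I U c) Set.univ where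
  toFun := shift L U c σ
  invFun := shift L U c σ.symm
  left_inv := shift_shift L U c (by simp)
  right_inv := shift_shift L U c (by simp)
  map_fun' {n} F x := by
    obtain ⟨s, f, hf, hx, hσ⟩ := exists_representatives L U c x
    refine Subtype.ext ?_
    have h1 : (Structure.funMap F x : supported L (orderUltrafilter I U c) Set.univ).1 =
        toPower fun y => Structure.funMap F fun k => f k y := by
      refine Eq.trans ?_ (Ultraproduct.funMap_cast F f)
      exact congrArg (Structure.funMap F) (funext hx)
    have h2 := coe_shift L U c σ (s := s) (fun y z h => by simp only [fun k => hf k h]) _ h1.symm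
    refine h2.trans (Eq.trans ?_ (congrArg (Structure.funMap F) (funext (hσ σ))).symm)
    exact (Ultraproduct.funMap_cast F fun k y => f k (y ∘ σ)).symm
  map_rel' {n} R x := by
    obtain ⟨s, f, hf, hx, hσ⟩ := exists_representatives L U c x
    have h1 : Structure.RelMap R x ↔ Structure.RelMap R fun k => (x k : Power (orderUltrafilter I U c)) := Iff.rfl
    have h2 : Structure.RelMap R (shift L U c σ ∘ x) ↔
        Structure.RelMap R fun k => (shift L U c σ (x k) : Power (orderUltrafilter I U c)) := Iff.rfl
    rw [h1, h2, funext hx, funext (hσ σ), relMap_toPower, relMap_toPower]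
    exact eventually_orderUltrafilter_comp U c σ (s := s)
      (P := fun y => Structure.RelMap R fun k => f k y)
      fun y z h => by simp only [fun k => hf k h]

theorem shiftEquiv_iterate_mem (σ : I ≃o I) (n : ℕ) :
    ∀ {S : Set I} {q : supported L (orderUltrafilter I U c) Set.univ},
      (q : Power (orderUltrafilter I U c)) ∈ supported L (orderUltrafilter I U c) S →
      ((shiftEquiv L U c σ)^[n] q : Power (orderUltrafilter I U c)) ∈
        supported L (orderUltrafilter I U c) (σ^[n] '' S) := by
  induction n with
  | zero => intro S q hq; simpa using hq
  | succ n ih =>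
    rintro S q ⟨s, f, hs, hf, hq⟩
    rw [iterate_succ_apply, iterate_succ, Set.image_comp]
    refine ih ⟨_, _, ?_, dependsOn_comp σ.toEquiv hf, (coe_shift L U c σ hf q hq).symm⟩
    simpa using hs

theorem shiftEquiv_diagonal (σ : I ≃o I) (m : M) :
    shiftEquiv L U c σ ⟨_, diagonal_mem_supported L Set.univ m⟩ =
      ⟨_, diagonal_mem_supported L Set.univ m⟩ :=
  Subtype.ext (coe_shift L U c σ (s := ∅) (f := fun _ => m) (fun _ _ _ => rfl) _ rfl)

/-- If the powers of `σ` eventually move every finite set off itself, then a finitely supported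
element fixed by the induced automorphism lies in `M`. -/
theorem mem_range_of_shiftEquiv_iterate_eq (σ : I ≃o I)
    (hσ : ∀ (s : Finset I) (n : ℕ), 0 < n → ∃ k, Disjoint (s : Set I) (σ^[n * k] '' s))
    {n : ℕ} (hn : 0 < n) {q : supported L (orderUltrafilter I U c) Set.univ}
    (hq : (shiftEquiv L U c σ)^[n] q = q) :
    (q : Power (orderUltrafilter I U c)) ∈ Set.range (diagonal L (orderUltrafilter I U c)) := by
  obtain ⟨s, hs⟩ := exists_finset_mem_supported L q.2
  obtain ⟨k, hk⟩ := hσ s n hn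
  -- The element equals its image under the `n * k`-th iterate, so it is supported both on `s` and
  -- on the disjoint translate of `s`.
  rw [← supported_inter_supported L U c hk]
  refine ⟨hs, ?_⟩
  have := shiftEquiv_iterate_mem L U c σ (n * k) hs
  rwa [iterate_mul (shiftEquiv L U c σ), iterate_fixed hq] at this

end Shift

end Model

/-! ### The shift on copies of ℤ. -/

section IndexOrder

/-- The automorphism of `A ×ₗ ℤ` that adds one to the second coordinate. -/
def lexSucc (A : Type*) [LinearOrder A] : A ×ₗ ℤ ≃o A ×ₗ ℤ where
  toEquiv := ofLex.trans (((Equiv.refl A).prodCongr (Equiv.addRight (1 : ℤ))).trans toLex)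
  map_rel_iff' {x y} := by
    simp [Prod.Lex.le_iff]

theorem lexSucc_iterate (A : Type*) [LinearOrder A] (n : ℕ) (x : A ×ₗ ℤ) :
    (ofLex ((lexSucc A)^[n] x)).2 = (ofLex x).2 + n := by
  induction n with
  | zero => simp
  | succ n ih =>
    rw [iterate_succ_apply']
    have : ∀ y : A ×ₗ ℤ, (ofLex (lexSucc A y)).2 = (ofLex y).2 + 1 := fun _ => rfl
    rw [this, ih]
    push_cast
    ring

theorem exists_disjoint_lexSucc_iterate (A : Type*) [LinearOrder A] (s : Finset (A ×ₗ ℤ)) (n : ℕ)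
    (hn : 0 < n) :
    ∃ k, Disjoint (s : Set (A ×ₗ ℤ)) ((lexSucc A)^[n * k] '' s) := by
  let b : ℕ := s.sup fun x => (ofLex x).2.natAbs
  have hb : ∀ x ∈ s, (ofLex x).2.natAbs ≤ b := fun x hx =>
    Finset.le_sup (f := fun x : A ×ₗ ℤ => (ofLex x).2.natAbs) hx
  -- Second coordinates in `s` lie in `[-b, b]`, so a shift by at least `2 * b + 1` leaves that
  -- interval.
  refine ⟨2 * b + 1, Set.disjoint_left.2 ?_⟩
  rintro _ hy ⟨x, hx, rfl⟩
  have h1 := hb _ hx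
  have h2 := hb _ hy
  rw [lexSucc_iterate] at h2
  have h3 : 2 * b + 1 ≤ n * (2 * b + 1) := Nat.le_mul_of_pos_left _ hn
  omega

end IndexOrder

/-! ### Löwenheim–Skolem with an automorphism. -/

section LowenheimSkolem

/-- Function symbols for a permutation and its inverse. -/
inductive PermFunctions : ℕ → Type
  | fwd : PermFunctions 1
  | bwd : PermFunctions 1

/-- The language of a permutation and its inverse. -/
def permLanguage : FirstOrder.Language.{0, 0} :=
  ⟨PermFunctions, fun _ => Empty⟩

theorem card_permLanguage_le : permLanguage.card ≤ Cardinal.aleph0 := by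
  have h : ∀ n, Countable (permLanguage.Functions n) := fun n =>
    Injective.countable (f := fun s : PermFunctions n =>
      (match s with | .fwd => 0 | .bwd => 1 : ℕ)) (by rintro (_ | _) (_ | _) h <;> first | rfl | cases h)
  have h' : ∀ n, Countable (permLanguage.Relations n) := fun n =>
    inferInstanceAs (Countable Empty)
  exact Cardinal.mk_le_aleph0_iff.2
    (inferInstanceAs (Countable ((Σ n, permLanguage.Functions n) ⊕ Σ n, permLanguage.Relations n)))

/-- A permutation as a structure. -/
abbrev permStructure {N : Type*} (α : N ≃ N) : permLanguage.Structure N where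
  funMap {_} s x := match s with
    | .fwd => α (x 0)
    | .bwd => α.symm (x 0)
  RelMap r := r.elim

variable {L : FirstOrder.Language.{u, v}} {M : Type w} [L.Structure M] {N : Type t} [L.Structure N]

/-- A downward Löwenheim–Skolem theorem for a structure with an automorphism. -/
theorem exists_elementary_equiv_card_eq (e : M ↪ₑ[L] N) (α : N ≃[L] N) (s : Set N)
    (κ : Cardinal.{z}) (h₀ : Cardinal.aleph0 ≤ κ)
    (hs : Cardinal.lift.{z} (Cardinal.mk s) ≤ Cardinal.lift.{t} κ)
    (hes : Set.range e ⊆ s)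
    (hL : Cardinal.lift.{z} L.card ≤ Cardinal.lift.{max u v} κ)
    (hN : Cardinal.lift.{t} κ ≤ Cardinal.lift.{z} (Cardinal.mk N)) :
    ∃ (K : Type z) (_ : L.Structure K) (e' : M ↪ₑ[L] K) (α' : K ≃[L] K) (j : K → N),
      Cardinal.mk K = κ ∧ Injective j ∧ s ⊆ Set.range j ∧ (∀ m, j (e' m) = e m) ∧
        ∀ x, j (α' x) = α (j x) := by
  -- The symbol for the inverse ensures that `α` restricts to a bijection of the substructure.
  let : permLanguage.Structure N := permStructure α.toEquiv
  have hL' : Cardinal.lift.{z} (L.sum permLanguage).card ≤ Cardinal.lift.{max u v} κ := by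
    rw [Language.card_sum, Cardinal.lift_add]
    refine Cardinal.add_le_of_le (by simpa using h₀) ?_ ?_
    · simpa using hL
    · rw [Cardinal.lift_lift]
      refine (Cardinal.lift_le.2 card_permLanguage_le).trans ?_
      simpa using h₀
  obtain ⟨S, hsS, hS⟩ := exists_elementarySubstructure_card_eq (L.sum permLanguage) s κ h₀ hs
    hL' hN
  let : L.Structure S := (LHom.sumInl : L →ᴸ L.sum permLanguage).reduct S
  have : (LHom.sumInl : L →ᴸ L.sum permLanguage).IsExpansionOn S := LHom.isExpansionOn_reduct _ _
  let eS : M ↪ₑ[L] S :=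
    { toFun := fun m => ⟨e m, hsS (hes ⟨m, rfl⟩)⟩
      map_formula' := fun n φ x => by
        rw [← LHom.realize_onFormula (LHom.sumInl : L →ᴸ L.sum permLanguage),
          ← S.subtype.map_formula, LHom.realize_onFormula]
        exact e.map_formula φ x }
  have hf : ∀ x ∈ S, α x ∈ S := fun x hx =>
    S.toSubstructure.fun_mem (Sum.inr PermFunctions.fwd : (L.sum permLanguage).Functions 1)
      (fun _ => x) fun _ => hx
  have hb : ∀ x ∈ S, α.symm x ∈ S := fun x hx =>
    S.toSubstructure.fun_mem (Sum.inr PermFunctions.bwd : (L.sum permLanguage).Functions 1)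
      (fun _ => x) fun _ => hx
  let αS : S ≃[L] S :=
    { toFun := fun x => ⟨α x, hf x x.2⟩
      invFun := fun x => ⟨α.symm x, hb x x.2⟩
      left_inv := fun x => Subtype.ext (α.symm_apply_apply x)
      right_inv := fun x => Subtype.ext (α.apply_symm_apply x)
      map_fun' := fun f x => Subtype.ext (α.map_fun f fun k => (x k : N))
      map_rel' := fun r x => α.map_rel r fun k => (x k : N) }
  have hcard : Cardinal.lift.{z} (Cardinal.mk S) = Cardinal.lift.{t} (Cardinal.mk κ.out) := by
    rw [Cardinal.mk_out]; exact hS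
  obtain ⟨ε⟩ := Cardinal.lift_mk_eq'.1 hcard
  let : L.Structure κ.out := ε.inducedStructure
  let E : S ≃[L] κ.out := ε.inducedStructureEquiv
  refine ⟨κ.out, inferInstance, E.toElementaryEmbedding.comp eS, (E.comp αS).comp E.symm,
    fun x => (E.symm x : N), Cardinal.mk_out κ, Subtype.val_injective.comp E.symm.injective,
    fun x hx => ⟨E ⟨x, hsS hx⟩, ?_⟩, fun m => ?_, fun x => ?_⟩
  · simp
  · exact congrArg Subtype.val (E.symm_apply_apply (eS m))
  · exact congrArg Subtype.val (E.symm_apply_apply (αS (E.symm x)))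

end LowenheimSkolem

/-! ### The three constructions. -/

variable (L : FirstOrder.Language.{u, v}) (M : Type w) [L.Structure M] [Infinite M]

theorem hyperfilter_eventually_ne (m : M) : ∀ᶠ a in (hyperfilter M : Filter M), a ≠ m :=
  (Set.finite_singleton m).compl_mem_hyperfilter

theorem exists_elementary_extension_equiv (κ : Cardinal.{z})
    (hM : Cardinal.lift.{z} (Cardinal.mk M) ≤ Cardinal.lift.{w} κ)
    (hL : Cardinal.lift.{z} L.card ≤ Cardinal.lift.{max u v} κ) :
    ∃ (N : Type z) (_ : L.Structure N) (e : M ↪ₑ[L] N) (α : N ≃[L] N),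
      Cardinal.mk N = κ ∧
      Set.range e ≠ Set.univ ∧
      ∀ n : ℕ, 0 < n →
        (∀ m : M, (⇑α)^[n] (e m) = e m) ∧
        (∀ x : N, x ∉ Set.range e → (⇑α)^[n] x ≠ x) := by
  have h₀ : Cardinal.aleph0 ≤ κ := by
    have h1 : Cardinal.aleph0 ≤ Cardinal.lift.{z} (Cardinal.mk M) := by simp
    simpa using h1.trans hM
  let : LinearOrder κ.out := IsWellOrder.linearOrder WellOrderingRel
  let I := κ.out ×ₗ ℤ
  let c : M := Classical.arbitrary M
  let V := orderUltrafilter I (hyperfilter M) c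
  let N := supported L V Set.univ
  have hU := hyperfilter_eventually_ne M
  let e : M ↪ₑ[L] N :=
    { toFun := fun m => ⟨diagonal L V m, diagonal_mem_supported L Set.univ m⟩
      map_formula' := fun n φ x => by
        rw [← N.subtype.map_formula]
        exact (diagonal L V).map_formula φ x }
  let α : N ≃[L] N := shiftEquiv L (hyperfilter M) c (lexSucc κ.out)
  have he : ∀ q : N, (q : Power V) ∈ Set.range (diagonal L V) → q ∈ Set.range e := by
    rintro q ⟨m, hm⟩
    exact ⟨m, Subtype.ext hm⟩
  let d : I → N := fun i => ⟨toPower fun x => x i, coordinate_mem_supported L (Set.mem_univ i)⟩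
  have hd : Injective d := fun i j hij =>
    coordinate_injective (hyperfilter M) c hU (congrArg Subtype.val hij)
  have hdr : ∀ i, d i ∉ Set.range e := by
    rintro i ⟨m, hm⟩
    exact coordinate_notMem_range L (hyperfilter M) c hU i ⟨m, congrArg Subtype.val hm⟩
  -- Distinct coordinates are distinct elements, so `N` is large enough to cut down to cardinality
  -- κ.
  have hκ : Cardinal.lift.{max w z} κ ≤ Cardinal.lift.{z} (Cardinal.mk N) := by
    have h1 : Injective fun a : κ.out => d (toLex (a, 0)) := fun a b hab => by
      simpa using hd hab
    simpa using Cardinal.mk_le_of_injective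
      (Equiv.ulift.{z}.symm.injective.comp (h1.comp Equiv.ulift.{max w z}.injective))
  obtain ⟨a⟩ : Nonempty κ.out := by
    rw [← Cardinal.mk_ne_zero_iff, Cardinal.mk_out]
    exact (Cardinal.aleph0_pos.trans_le h₀).ne'
  obtain ⟨K, _, e', α', j, hK, hj, hsj, he', hα'⟩ := exists_elementary_equiv_card_eq e α
    -- Keeping one coordinate element makes the smaller extension proper.
    (insert (d (toLex (a, 0))) (Set.range e)) κ h₀ (by
      refine (Cardinal.lift_le.2 Cardinal.mk_insert_le).trans ?_
      rw [Cardinal.lift_add]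
      refine Cardinal.add_le_of_le (by simpa using h₀) ?_ ?_
      · have h1 : Cardinal.lift.{w} (Cardinal.mk (Set.range e)) ≤
            Cardinal.lift.{max w z} (Cardinal.mk M) := Cardinal.mk_range_le_lift
        rw [Cardinal.lift_id'.{w, z}] at h1
        rw [Cardinal.lift_id'.{z, w}]
        refine h1.trans ?_
        have h2 := Cardinal.lift_le.{max w z}.2 hM
        rwa [Cardinal.lift_lift, Cardinal.lift_lift] at h2
      · simpa using Cardinal.one_le_aleph0.trans h₀) (Set.subset_insert _ _) hL hκ
  have hrange : ∀ x, j x ∈ Set.range e → x ∈ Set.range e' := by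
    rintro x ⟨m, hm⟩
    exact ⟨m, hj ((he' m).trans hm)⟩
  have hiter : ∀ n x, j (α'^[n] x) = α^[n] (j x) := fun n =>
    (Semiconj.iterate_right (f := j) (ga := α') (gb := α) hα' n)
  refine ⟨K, _, e', α', hK, fun h => ?_, fun n hn => ⟨fun m => ?_, fun x hx h => ?_⟩⟩
  · obtain ⟨x, hx⟩ := hsj (Set.mem_insert _ _)
    obtain ⟨m, rfl⟩ : x ∈ Set.range e' := h ▸ Set.mem_univ x
    exact hdr _ ⟨m, (he' m).symm.trans hx⟩
  · refine hj ?_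
    rw [hiter, he']
    exact iterate_fixed (shiftEquiv_diagonal L (hyperfilter M) c _ m) n
  · refine hx (hrange x (he _ ?_))
    refine mem_range_of_shiftEquiv_iterate_eq L (hyperfilter M) c _
      (exists_disjoint_lexSucc_iterate κ.out) hn ?_
    exact (hiter n x).symm.trans (congrArg j h)

/-- Common source of (B) and (C); the finite-support clause is what (B) needs to compute the
intersection. -/
theorem exists_elementarySubstructure_family (I : Type t) [LinearOrder I] :
    ∃ (N : Type (max w t)) (_ : L.Structure N) (e : M ↪ₑ[L] N)
      (F : Set I → L.ElementarySubstructure N),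
      (∀ S, Set.range e ⊆ (F S : Set N)) ∧
      (∀ S, S.Nonempty → Set.range e ⊂ (F S : Set N)) ∧
      (∀ S₀ S₁, S₀ ⊆ S₁ → F S₀ ≤ F S₁) ∧
      (∀ S₀ S₁, Disjoint S₀ S₁ → (F S₀ : Set N) ∩ (F S₁ : Set N) = Set.range e) ∧
      ∀ S, ∀ x ∈ F S, ∃ s : Finset I, x ∈ F s := by
  let c : M := Classical.arbitrary M
  let V := orderUltrafilter I (hyperfilter M) c
  have h1 : ∀ S, Set.range (diagonal L V) ⊆ (supported L V S : Set (Power V)) := by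
    rintro S _ ⟨m, rfl⟩
    exact diagonal_mem_supported L S m
  refine ⟨Power V, inferInstance, diagonal L V, supported L V, h1, fun S ⟨i, hi⟩ => ?_,
    fun S₀ S₁ => supported_mono L,
    fun S₀ S₁ => supported_inter_supported L (hyperfilter M) c,
    fun S x => exists_finset_mem_supported L⟩
  refine (Set.ssubset_iff_of_subset (h1 S)).2 ⟨_, coordinate_mem_supported L hi, ?_⟩
  exact coordinate_notMem_range L (hyperfilter M) c (hyperfilter_eventually_ne M) i

theorem exists_decreasing_elementarySubstructures :
    ∃ (N : Type (max u v w)) (_ : L.Structure N) (e : M ↪ₑ[L] N)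
      (F : ℕ → L.ElementarySubstructure N),
      (∀ i, Set.range e ⊂ (F i : Set N)) ∧
      (∀ i, F (i + 1) < F i) ∧
      (⋂ i, (F i : Set N)) = Set.range e := by
  obtain ⟨N, _, e, F, h1, h2, h3, h4, h5⟩ :=
    exists_elementarySubstructure_family L M (ULift.{max u v} ℕ)
  let T : ℕ → Set (ULift.{max u v} ℕ) := fun i => {k | i ≤ k.down}
  refine ⟨N, _, e, fun i => F (T i), fun i => h2 _ ⟨⟨i⟩, le_refl i⟩, fun i => ?_, ?_⟩
  · refine lt_of_le_of_ne (h3 _ _ fun k hk => (Nat.le_succ i).trans hk) fun h => ?_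
    have hd : Disjoint ({⟨i⟩} : Set (ULift.{max u v} ℕ)) (T (i + 1)) :=
      Set.disjoint_singleton_left.2 fun hi => Nat.not_succ_le_self i hi
    have := h4 _ _ hd
    rw [show F (T (i + 1)) = F (T i) from h, Set.inter_eq_left.2 (h3 _ _ (by simp [T]))] at this
    exact (h2 _ (Set.singleton_nonempty _)).ne this.symm
  · refine subset_antisymm (fun x hx => ?_) (Set.subset_iInter fun i => h1 _)
    rw [Set.mem_iInter] at hx
    obtain ⟨s, hs⟩ := h5 _ x (hx 0)
    -- A bound beyond every index in the finite support of `x`, so that `T b` misses it.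
    let b := s.sup ULift.down + 1
    have hd : Disjoint (s : Set (ULift.{max u v} ℕ)) (T b) :=
      Set.disjoint_left.2 fun k hk hkb =>
        absurd (Finset.le_sup (f := ULift.down) hk) (not_le.2 (Nat.lt_of_succ_le hkb))
    rw [← h4 _ _ hd]
    exact ⟨hs, hx b⟩

end IteratedUltrapower

theorem mainTheorem3 (L : FirstOrder.Language.{u, v}) (M : Type w)
    [L.Structure M] [Infinite M] :
    -- (A)
    (∀ κ : Cardinal.{z},
      Cardinal.lift.{z} (Cardinal.mk M) ≤ Cardinal.lift.{w} κ →
      Cardinal.lift.{z} L.card ≤ Cardinal.lift.{max u v} κ →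
      ∃ (N : Type z) (_ : L.Structure N) (e : M ↪ₑ[L] N) (α : N ≃[L] N),
        Cardinal.mk N = κ ∧
        Set.range e ≠ Set.univ ∧
        ∀ n : ℕ, 0 < n →
          (∀ m : M, (⇑α)^[n] (e m) = e m) ∧
          (∀ x : N, x ∉ Set.range e → (⇑α)^[n] x ≠ x)) ∧
    -- (B)
    (∃ (N : Type (max u v w)) (_ : L.Structure N) (e : M ↪ₑ[L] N)
        (F : ℕ → L.ElementarySubstructure N),
        (∀ i, Set.range e ⊂ (F i : Set N)) ∧
        (∀ i, F (i + 1) < F i) ∧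
        (⋂ i, (F i : Set N)) = Set.range e) ∧
    -- (C)
    (∀ I : Type t,
      ∃ (N : Type (max u v w t)) (_ : L.Structure N) (e : M ↪ₑ[L] N)
        (F : Set I → L.ElementarySubstructure N),
        (∀ S, Set.range e ⊆ (F S : Set N)) ∧
        (∀ S, S.Nonempty → Set.range e ⊂ (F S : Set N)) ∧
        (∀ S₀ S₁, S₀ ⊆ S₁ → F S₀ ≤ F S₁) ∧
        (∀ S₀ S₁, Disjoint S₀ S₁ →
          (F S₀ : Set N) ∩ (F S₁ : Set N) = Set.range e)) := by
  refine ⟨IteratedUltrapower.exists_elementary_extension_equiv L M,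
    IteratedUltrapower.exists_decreasing_elementarySubstructures L M, fun I => ?_⟩
  -- Any linear order serves here; the lift only adjusts the universe.
  let : LinearOrder (ULift.{max u v} I) := IsWellOrder.linearOrder WellOrderingRel
  obtain ⟨N, _, e, F, h1, h2, h3, h4, -⟩ :=
    IteratedUltrapower.exists_elementarySubstructure_family L M (ULift.{max u v} I)
  refine ⟨N, _, e, fun S => F (ULift.down ⁻¹' S), fun S => h1 _,
    fun S hS => h2 _ (hS.preimage ULift.down_surjective),
    fun S₀ S₁ h => h3 _ _ (Set.preimage_mono h),
    fun S₀ S₁ h => h4 _ _ (h.preimage _)⟩
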